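/- Let $$H=\tfrac1{\sqrt2}\begin{pmatrix}1&1\\1&-1\end{pmatrix},\quad T=\begin{pmatrix}1&0\\0&e^{i\pi/4}\end{pmatrix},\quad \sigma_y=\begin{pmatrix}0&-i\\i&0\end{pmatrix},\quad \Lambda Z=\mathrm{diag}(1,1,1,-1)$$ (the last one in the two-qubit basis $00,01,10,11$). The gate family $\mathcal U=\{HT,\sigma_y,\Lambda Z\}$ is approximately universal: for every number $n$ of qubits, every unitary transformation $U$ of $(\mathbb C^2)^{\otimes n}$ and every $\delta>0$ there are a finite circuit on these $n$ qubits (with no ancillary qubits), each of whose gates is a member of $\mathcal U$ applied to some of the $n$ qubits, and a real number $\varphi$, such that the unitary transformation $V$ computed by the circuit satisfies $\|U-e^{i\varphi}V\|<\delta$ in operator norm. -/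

import Mathlib

namespace QubitCircuit

/-- Computational basis labels of `n` qubits. -/
abbrev Basis (n : ℕ) : Type := Fin n → Fin 2

/-- Linear operators on the state space `(ℂ²)^{⊗ n}` of `n` qubits, written as matrices in the
computational basis. -/
abbrev Operator (n : ℕ) : Type := Matrix (Basis n) (Basis n) ℂ

/-- Unitary transformations of `n` qubits. -/
abbrev QUnitary (n : ℕ) : Type := ↥(Matrix.unitaryGroup (Basis n) ℂ)

/-- A gate: a number of qubits together with a unitary transformation of that many qubits. -/
abbrev Gate : Type := Σ k : ℕ, QUnitary k

/-- The operator on `n` qubits that applies the `k`-qubit operator `A` to the (pairwise distinct)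
qubits `w 0, …, w (k - 1)` and the identity to all the other qubits. -/
def applyOn {k n : ℕ} (w : Fin k ↪ Fin n) (A : Operator k) : Operator n :=
  Matrix.of fun x y =>
    if ∀ j : Fin n, j ∉ Set.range w → x j = y j then A (x ∘ w) (y ∘ w) else 0

/-- The operators on `n` qubits computed by finite circuits (without ancillary qubits) whose gates
are taken from `S`, each applied to any choice of distinct qubits. The empty circuit is the
identity. -/
def circuits (S : Set Gate) (n : ℕ) : Submonoid (Operator n) :=
  Submonoid.closure
    {M | ∃ g ∈ S, ∃ w : Fin g.1 ↪ Fin n, M = applyOn w (g.2 : Operator g.1)}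

open scoped Matrix.Norms.L2Operator in
/-- A family `S` of gates is approximately universal if every unitary transformation of any number
of qubits is, in operator norm and up to a global phase, a limit of circuits over `S`. -/
def ApproximatelyUniversal (S : Set Gate) : Prop :=
  ∀ (n : ℕ) (U : QUnitary n) (δ : ℝ), 0 < δ →
    ∃ V ∈ circuits S n, ∃ φ : ℝ,
      ‖(U : Operator n) - Complex.exp (φ * Complex.I) • V‖ < δ

/-- The Hadamard matrix. -/
noncomputable def hadamard : Matrix (Fin 2) (Fin 2) ℂ :=
  (1 / (Real.sqrt 2 : ℂ)) • !![1, 1; 1, -1]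

/-- The matrix `T`, with diagonal `1, exp (i π / 4)`. -/
noncomputable def phaseT : Matrix (Fin 2) (Fin 2) ℂ :=
  !![1, 0; 0, Complex.exp (Complex.I * Real.pi / 4)]

/-- The Pauli matrix `σ_y`. -/
def sigmaY : Matrix (Fin 2) (Fin 2) ℂ :=
  !![0, -Complex.I; Complex.I, 0]

/-- The controlled-`Z` matrix, in the basis `00, 01, 10, 11`. -/
def controlledZ : Matrix (Fin 4) (Fin 4) ℂ :=
  !![1, 0, 0, 0; 0, 1, 0, 0; 0, 0, 1, 0; 0, 0, 0, -1]

theorem hadamard_mem : hadamard ∈ Matrix.unitaryGroup (Fin 2) ℂ := by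
  have h : (Real.sqrt 2 : ℂ) * (Real.sqrt 2 : ℂ) = 2 := by
    rw [← Complex.ofReal_mul, Real.mul_self_sqrt (by norm_num)]; norm_num
  have h0 : (Real.sqrt 2 : ℂ) ≠ 0 := by
    intro h1; rw [h1] at h; norm_num at h
  have h2 : (Real.sqrt 2 : ℂ)⁻¹ * (Real.sqrt 2 : ℂ)⁻¹ = 1 / 2 := by
    rw [← mul_inv, h]; norm_num
  rw [Matrix.mem_unitaryGroup_iff]
  ext i j
  fin_cases i <;> fin_cases j <;>
    simp [hadamard, Matrix.mul_apply, Fin.sum_univ_two, Matrix.star_apply, Complex.conj_ofReal,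
      h2] <;> norm_num

theorem phaseT_mem : phaseT ∈ Matrix.unitaryGroup (Fin 2) ℂ := by
  have h : Complex.exp (Complex.I * Real.pi / 4) *
      (starRingEnd ℂ) (Complex.exp (Complex.I * Real.pi / 4)) = 1 := by
    have h4 : (starRingEnd ℂ) (4 : ℂ) = 4 := Complex.conj_ofNat 4
    rw [← Complex.exp_conj, ← Complex.exp_add]
    simp [Complex.conj_ofReal, h4, neg_div]
  rw [Matrix.mem_unitaryGroup_iff]
  ext i j
  fin_cases i <;> fin_cases j <;>
    simp [phaseT, Matrix.mul_apply, Fin.sum_univ_two, Matrix.star_apply, h]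

theorem sigmaY_mem : sigmaY ∈ Matrix.unitaryGroup (Fin 2) ℂ := by
  rw [Matrix.mem_unitaryGroup_iff]
  ext i j
  fin_cases i <;> fin_cases j <;>
    simp [sigmaY, Matrix.mul_apply, Fin.sum_univ_two, Matrix.star_apply]

theorem controlledZ_mem : controlledZ ∈ Matrix.unitaryGroup (Fin 4) ℂ := by
  rw [Matrix.mem_unitaryGroup_iff]
  ext i j
  fin_cases i <;> fin_cases j <;>
    simp [controlledZ, Matrix.mul_apply, Fin.sum_univ_four, Matrix.star_apply]

/-- Transport of unitarity along a relabelling of the basis. -/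
theorem submatrix_mem {ι κ : Type} [Fintype ι] [DecidableEq ι] [Fintype κ] [DecidableEq κ]
    (e : κ ≃ ι) {A : Matrix ι ι ℂ} (hA : A ∈ Matrix.unitaryGroup ι ℂ) :
    A.submatrix e e ∈ Matrix.unitaryGroup κ ℂ := by
  rw [Matrix.mem_unitaryGroup_iff] at hA ⊢
  rw [Matrix.star_eq_conjTranspose, Matrix.conjTranspose_submatrix,
    Matrix.submatrix_mul_equiv, ← Matrix.star_eq_conjTranspose, hA, Matrix.submatrix_one_equiv]

/-- The one-qubit gate given by a unitary `2 × 2` matrix. -/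
def oneQubitGate (A : Matrix (Fin 2) (Fin 2) ℂ) (hA : A ∈ Matrix.unitaryGroup (Fin 2) ℂ) : Gate :=
  ⟨1, A.submatrix (Equiv.funUnique (Fin 1) (Fin 2)) (Equiv.funUnique (Fin 1) (Fin 2)),
    submatrix_mem _ hA⟩

/-- The basis labels of two qubits in the order `00, 01, 10, 11`. -/
def twoQubitOrder : Basis 2 ≃ Fin 4 :=
  (finTwoArrowEquiv (Fin 2)).trans finProdFinEquiv

/-- The two-qubit gate given by a unitary `4 × 4` matrix in the basis `00, 01, 10, 11`. -/
def twoQubitGate (A : Matrix (Fin 4) (Fin 4) ℂ) (hA : A ∈ Matrix.unitaryGroup (Fin 4) ℂ) : Gate :=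
  ⟨2, A.submatrix twoQubitOrder twoQubitOrder, submatrix_mem _ hA⟩

/-- The family `{HT, σ_y, ΛZ}`. -/
noncomputable def gateFamily : Set Gate :=
  {oneQubitGate (hadamard * phaseT) (mul_mem hadamard_mem phaseT_mem),
    oneQubitGate sigmaY sigmaY_mem,
    twoQubitGate controlledZ controlledZ_mem}

end QubitCircuit

/-! Let `G` be the closure of the subgroup of unitaries generated by all scalar phases and all
circuits. The task is to show `G = ⊤` by computing its Lie algebra, `generators`: the self-adjoint
`X` whose one-parameter group exp(itX) lies in `G`. Closedness of `G` and the Trotter formula make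
it a real vector space, stable under conjugation by `G`.

A first element comes from number theory: up to a phase, HT is exp(iθK) with K² = 1 and θ/π
irrational, so its powers and the phases fill out the whole group exp(itK) in the closure. Averaging
K over conjugation by σ_y isolates σ_y. Conjugation by HT turns any single Pauli matrix into all
three (`pauli_mem_of_conj_invariant`), and conjugation by ΛZ turns X⊗1 into X⊗Z, which spreads Pauli
strings to larger supports (`pauli_tensor_mem_generators`). The strings span all self-adjoint
operators, and exponentials of these give every unitary (`eq_top_of_generators`).

Inverses of gates are dispensable: in a compact group a submonoid and the subgroup it generates have
the same closure. The phases used collect into the single φ. -/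

namespace QubitCircuit

open Filter Topology

/-! ### The Lie–Trotter product formula -/

section Trotter

/-- Telescoping. Positive exponents avoid any assumption on ‖1‖. -/
theorem norm_pow_sub_pow_le {A : Type*} [NormedRing A] {a b : A} (ha : ‖a‖ ≤ 1) (hb : ‖b‖ ≤ 1)
    (n : ℕ) : ‖a ^ (n + 1) - b ^ (n + 1)‖ ≤ (n + 1) * ‖a - b‖ := by
  induction n with
  | zero => simp
  | succ n ih =>
    have h : a ^ (n + 1 + 1) - b ^ (n + 1 + 1)
        = a ^ (n + 1) * (a - b) + (a ^ (n + 1) - b ^ (n + 1)) * b := by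
      rw [pow_succ a, pow_succ b]; noncomm_ring
    have h1 : ‖a ^ (n + 1)‖ ≤ 1 :=
      (norm_pow_le' a n.succ_pos).trans (pow_le_one₀ (norm_nonneg _) ha)
    rw [h]
    calc _ ≤ ‖a ^ (n + 1)‖ * ‖a - b‖ + ‖a ^ (n + 1) - b ^ (n + 1)‖ * ‖b‖ :=
          (norm_add_le _ _).trans (add_le_add (norm_mul_le _ _) (norm_mul_le _ _))
      _ ≤ 1 * ‖a - b‖ + ((n + 1) * ‖a - b‖) * 1 := by gcongr
      _ = _ := by push_cast; ring

variable {A : Type*} [NormedRing A] [NormedAlgebra ℝ A] [CompleteSpace A]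

theorem hasDerivAt_exp_mul_exp_sub_exp (X Y : A) :
    HasDerivAt (fun s : ℝ ↦ NormedSpace.exp (s • X) * NormedSpace.exp (s • Y)
      - NormedSpace.exp (s • (X + Y))) 0 0 := by
  have h (Z : A) : HasDerivAt (fun s : ℝ ↦ NormedSpace.exp (s • Z)) Z 0 := by
    simpa using hasDerivAt_exp_smul_const (𝕂 := ℝ) Z (0 : ℝ)
  have h' := ((h X).mul (h Y)).sub (h (X + Y))
  simp only [zero_smul, NormedSpace.exp_zero, one_mul, mul_one, sub_self] at h'
  exact h'

/-- Telescoping bounds the error by n + 1 times the one-step error at s = 1/(n+1). This is the norm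
of a difference quotient at 0 of a function with zero derivative there. -/
theorem tendsto_exp_mul_exp_pow (X Y : A)
    (h : ∀ s : ℝ, ‖NormedSpace.exp (s • X) * NormedSpace.exp (s • Y)‖ ≤ 1)
    (h' : ∀ s : ℝ, ‖NormedSpace.exp (s • (X + Y))‖ ≤ 1) :
    Tendsto (fun n : ℕ ↦ (NormedSpace.exp ((1 / ((n : ℝ) + 1)) • X)
      * NormedSpace.exp ((1 / ((n : ℝ) + 1)) • Y)) ^ (n + 1)) atTop
      (𝓝 (NormedSpace.exp (X + Y))) := by
  have hd := (hasDerivAt_exp_mul_exp_sub_exp X Y).tendsto_slope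
  have hu : Tendsto (fun n : ℕ ↦ 1 / ((n : ℝ) + 1)) atTop (𝓝[≠] 0) :=
    tendsto_nhdsWithin_iff.2 ⟨tendsto_one_div_add_atTop_nhds_zero_nat,
      Eventually.of_forall fun n ↦ by simp; positivity⟩
  have h0 := (hd.comp hu).norm
  rw [tendsto_iff_norm_sub_tendsto_zero]
  refine squeeze_zero (fun _ ↦ norm_nonneg _) (fun n ↦ ?_) (by simpa using h0)
  have hn : (0 : ℝ) < (n : ℝ) + 1 := by positivity
  have he : NormedSpace.exp (X + Y)
      = NormedSpace.exp ((1 / ((n : ℝ) + 1)) • (X + Y)) ^ (n + 1) := by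
    let +nondep : NormedAlgebra ℚ A := .restrictScalars ℚ ℝ A
    rw [← NormedSpace.exp_nsmul, ← Nat.cast_smul_eq_nsmul ℝ, smul_smul]
    push_cast
    rw [mul_one_div_cancel hn.ne', one_smul]
  rw [he]
  refine (norm_pow_sub_pow_le (h _) (h' _) n).trans (le_of_eq ?_)
  simp [slope, norm_smul, abs_of_pos hn]

end Trotter

/-! ### The Lie algebra of a closed group of unitaries -/

section Generators

open selfAdjoint

variable {A : Type*} [CStarAlgebra A]

theorem exp_smul_selfAdjoint_norm_le (X : selfAdjoint A) (s : ℝ) :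
    ‖NormedSpace.exp (s • (Complex.I • (X : A)))‖ ≤ 1 := by
  have h : NormedSpace.exp (s • (Complex.I • (X : A))) = (expUnitary (s • X) : A) := by
    simp [smul_comm s Complex.I]
  rw [h]
  obtain _ | _ := subsingleton_or_nontrivial A
  · rw [Subsingleton.elim (expUnitary (s • X) : A) 0, norm_zero]
    exact zero_le_one
  · exact (CStarRing.norm_of_mem_unitary (expUnitary (s • X)).2).le

theorem tendsto_expUnitary_mul_pow (X Y : selfAdjoint A) :
    Tendsto (fun n : ℕ ↦ (expUnitary ((1 / ((n : ℝ) + 1)) • X)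
      * expUnitary ((1 / ((n : ℝ) + 1)) • Y)) ^ (n + 1)) atTop (𝓝 (expUnitary (X + Y))) := by
  rw [tendsto_subtype_rng]
  have h := tendsto_exp_mul_exp_pow (Complex.I • (X : A)) (Complex.I • (Y : A))
    (fun s ↦ (norm_mul_le _ _).trans (mul_le_one₀ (exp_smul_selfAdjoint_norm_le X s)
      (norm_nonneg _) (exp_smul_selfAdjoint_norm_le Y s)))
    (fun s ↦ by rw [← smul_add]; exact exp_smul_selfAdjoint_norm_le (X + Y) s)
  simpa [smul_comm _ Complex.I] using h

/-- The Lie algebra (in the self-adjoint convention) of a closed group of unitaries. -/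
def generators (G : Subgroup (unitary A)) (hG : IsClosed (G : Set (unitary A))) :
    Submodule ℝ A where
  carrier := {X | ∃ h : X ∈ selfAdjoint A, ∀ t : ℝ, expUnitary (t • ⟨X, h⟩) ∈ G}
  zero_mem' := ⟨zero_mem _, fun t ↦ by
    have h : (⟨0, zero_mem _⟩ : selfAdjoint A) = 0 := rfl
    simp [h, one_mem]⟩
  add_mem' := by
    rintro X Y ⟨hX, hX'⟩ ⟨hY, hY'⟩
    refine ⟨add_mem hX hY, fun t ↦ ?_⟩
    have h : t • (⟨X + Y, add_mem hX hY⟩ : selfAdjoint A) = t • ⟨X, hX⟩ + t • ⟨Y, hY⟩ := by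
      ext; simp
    rw [h]
    -- The sum is reached as a Trotter limit of elements of `G`; this is where closedness enters.
    refine hG.mem_of_tendsto (tendsto_expUnitary_mul_pow _ _) (Eventually.of_forall fun n ↦ ?_)
    simp only [smul_smul]
    exact pow_mem (mul_mem (hX' _) (hY' _)) _
  smul_mem' := by
    rintro c X ⟨hX, hX'⟩
    refine ⟨(c • (⟨X, hX⟩ : selfAdjoint A)).2, fun t ↦ ?_⟩
    have h : t • (⟨c • X, (c • (⟨X, hX⟩ : selfAdjoint A)).2⟩ : selfAdjoint A)
        = (t * c) • ⟨X, hX⟩ := by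
      ext; simp [smul_smul]
    rw [h]
    exact hX' _

variable {G : Subgroup (unitary A)} {hG : IsClosed (G : Set (unitary A))}

theorem conj_mem_generators {X : A} {g : unitary A} (hg : g ∈ G) (hX : X ∈ generators G hG) :
    (g : A) * X * star (g : A) ∈ generators G hG := by
  obtain ⟨h, hX⟩ := hX
  have hs : (g : A) * X * star (g : A) ∈ selfAdjoint A := by
    rw [selfAdjoint.mem_iff] at h ⊢
    simp [h, mul_assoc]
  refine ⟨hs, fun t ↦ ?_⟩
  have he : expUnitary (t • ⟨_, hs⟩) = g * expUnitary (t • ⟨X, h⟩) * g⁻¹ := by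
    ext
    let +nondep : NormedAlgebra ℚ A := .restrictScalars ℚ ℂ A
    have := NormedSpace.exp_units_conj (Unitary.toUnits g) (Complex.I • t • X)
    have hi : ((Unitary.toUnits g)⁻¹ : Aˣ) = star (g : A) := rfl
    have hi' : ((g⁻¹ : unitary A) : A) = star (g : A) := rfl
    simpa [mul_assoc, hi, hi'] using this
  rw [he]
  exact mul_mem (mul_mem hg (hX t)) (inv_mem hg)

/-- Both sides solve the same linear differential equation: E(t)P(-t) has zero derivative, hence
equals 1, and P(-t) is inverse to P(t). -/
theorem expUnitary_smul_of_sq_eq_one (X : selfAdjoint A) (hX : (X : A) * X = 1) (t : ℝ) :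
    (expUnitary (t • X) : A) = (Real.cos t : ℂ) • (1 : A)
      + (Real.sin t * Complex.I : ℂ) • (X : A) := by
  let P : ℝ → A := fun t ↦ (Real.cos t : ℂ) • (1 : A) + (Real.sin t * Complex.I : ℂ) • (X : A)
  let E : ℝ → A := fun t ↦ NormedSpace.exp (t • (Complex.I • (X : A)))
  have hP (t : ℝ) : HasDerivAt P (Complex.I • (X : A) * P t) t := by
    have h := ((Real.hasDerivAt_cos t).ofReal_comp.smul_const (1 : A)).add
      (((Real.hasDerivAt_sin t).ofReal_comp.mul_const Complex.I).smul_const (X : A))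
    refine h.congr_deriv ?_
    simp only [P, mul_add, mul_smul_comm, smul_mul_assoc, hX, mul_one, smul_smul]
    rw [add_comm, mul_assoc _ Complex.I Complex.I, Complex.I_mul_I]
    simp
  have hPn (t : ℝ) : HasDerivAt (fun t ↦ P (-t)) (-(Complex.I • (X : A) * P (-t))) t := by
    have h := (hP (-t)).scomp t (hasDerivAt_neg t)
    rw [neg_one_smul] at h
    exact h
  have hE (t : ℝ) : HasDerivAt E (E t * (Complex.I • (X : A))) t :=
    hasDerivAt_exp_smul_const (𝕂 := ℝ) (Complex.I • (X : A)) t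
  have hF (t : ℝ) : HasDerivAt (fun t ↦ E t * P (-t)) 0 t := by
    refine ((hE t).mul (hPn t)).congr_deriv ?_
    rw [mul_neg, mul_assoc, add_neg_cancel]
  have hconst : E t * P (-t) = E 0 * P (-0) :=
    is_const_of_deriv_eq_zero (fun s ↦ (hF s).differentiableAt) (fun s ↦ (hF s).deriv) t 0
  have hone : E 0 * P (-0) = 1 := by simp [E, P]
  have hinv : P (-t) * P t = 1 := by
    have hcs : (Real.cos t : ℂ) * Real.cos t + Real.sin t * Real.sin t = 1 := by
      rw [← sq, ← sq]; exact_mod_cast Real.cos_sq_add_sin_sq t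
    have hI : -(Real.sin t * Complex.I * (Real.sin t * Complex.I) : ℂ)
        = Real.sin t * Real.sin t := by linear_combination (-(Real.sin t : ℂ) ^ 2) * Complex.I_sq
    simp only [P, Real.cos_neg, Real.sin_neg, Complex.ofReal_neg, neg_mul, neg_smul, mul_add,
      add_mul, smul_mul_smul_comm, hX, mul_one, one_mul]
    rw [← neg_smul _ (1 : A), hI, mul_comm (Real.cos t : ℂ) (_ * Complex.I)]
    trans ((Real.cos t : ℂ) * Real.cos t + Real.sin t * Real.sin t) • (1 : A)
    · rw [add_smul]; abel
    · rw [hcs, one_smul]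
  have hEP : E t = P t := by
    rw [← mul_one (E t), ← hinv, ← mul_assoc, hconst, hone, one_mul]
  rw [← show E t = (expUnitary (t • X) : A) by simp [E, smul_comm t Complex.I], hEP]

/-- The times t with exp(itX) in `G` form a closed subgroup of ℝ. It contains θ, and π because
exp(iπX) = -1; as θ/π is irrational, it is dense. -/
theorem mem_generators_of_irrational {X : A} (hs : X ∈ selfAdjoint A) (hX : X * X = 1) {θ : ℝ}
    (hθ : Irrational (θ / Real.pi)) (h1 : (-1 : unitary A) ∈ G)
    (h : expUnitary (θ • ⟨X, hs⟩) ∈ G) : X ∈ generators G hG := by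
  refine ⟨hs, fun t ↦ ?_⟩
  let f : ℝ → unitary A := fun t ↦ expUnitary (t • ⟨X, hs⟩)
  have hf : Continuous f := by fun_prop
  have hadd (s t : ℝ) : f (s + t) = f s * f t := by
    have hc : Commute ((s • (⟨X, hs⟩ : selfAdjoint A) : selfAdjoint A) : A)
        ((t • (⟨X, hs⟩ : selfAdjoint A) : selfAdjoint A) : A) := by
      simpa using ((Commute.refl X).smul_left s).smul_right t
    simp only [f, add_smul, hc.expUnitary_add]
  have hzero : f 0 = 1 := by simp [f]
  let S : AddSubgroup ℝ :=
    { carrier := {t | f t ∈ G}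
      zero_mem' := by simp [hzero, one_mem]
      add_mem' := fun {a b} ha hb ↦ by
        simp only [Set.mem_ofPred_eq, hadd] at *
        exact mul_mem ha hb
      neg_mem' := fun {a} ha ↦ by
        have : f (-a) = (f a)⁻¹ := by
          rw [eq_inv_iff_mul_eq_one, ← hadd, neg_add_cancel, hzero]
        simp only [Set.mem_ofPred_eq, this] at *
        exact inv_mem ha }
  have hcl : IsClosed (S : Set ℝ) := hG.preimage hf
  have hpi : Real.pi ∈ S := by
    change f Real.pi ∈ G
    convert h1
    ext
    simp only [f]
    rw [expUnitary_smul_of_sq_eq_one _ hX]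
    simp only [Real.cos_pi, Real.sin_pi, Complex.ofReal_zero, zero_mul, zero_smul, add_zero]
    simp only [Complex.ofReal_neg, Complex.ofReal_one, neg_smul, one_smul]
    rfl
  have hd := dense_addSubgroupClosure_pair_iff.2 hθ
  have hle : AddSubgroup.closure {θ, Real.pi} ≤ S := by
    rw [AddSubgroup.closure_le]
    rintro x (rfl | rfl)
    exacts [h, hpi]
  have := hd.mono hle
  have ht := this t
  rw [hcl.closure_eq] at ht
  exact ht

/-- A unitary without -1 in its spectrum is exp of i times its self-adjoint argument. A finite
spectrum can be rotated off -1 by a phase, itself an exponential in `G`. -/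
theorem eq_top_of_generators (hf : ∀ u : unitary A, (spectrum ℂ (u : A)).Finite)
    (h : ∀ X ∈ selfAdjoint A, X ∈ generators G hG) : G = ⊤ := by
  rw [eq_top_iff]
  rintro u -
  have key (X : selfAdjoint A) : expUnitary X ∈ G := by
    obtain ⟨_, h⟩ := h X X.2
    simpa using h 1
  let o : selfAdjoint A := ⟨1, .one A⟩
  -- The value at α is the spectral point of u that the phase exp(iα) would carry to -1.
  let f : ℝ → ℂ := fun α ↦ -Complex.exp (-α * Complex.I)
  have hinj : Set.InjOn f (Set.Ioo 0 1) := by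
    intro a ha b hb hab
    have hl (c : ℝ) (hc : c ∈ Set.Ioo (0 : ℝ) 1) : Complex.arg (-f c) = -c := by
      have := Real.pi_gt_three
      simp only [f, neg_neg]
      rw [← Complex.ofReal_neg, ← Circle.coe_exp,
        Circle.arg_exp (by linarith [hc.2]) (by linarith [hc.1])]
    rw [← neg_inj, ← hl a ha, ← hl b hb, hab]
  obtain ⟨_, ⟨α, -, rfl⟩, hα⟩ :=
    ((Set.Ioo_infinite (zero_lt_one (α := ℝ))).image hinj).exists_notMem_finite (hf u)
  have hexp : (expUnitary (α • o) : A) = Complex.exp (α * Complex.I) • (1 : A) := by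
    rw [expUnitary_smul_of_sq_eq_one o (one_mul 1), ← add_smul, Complex.exp_mul_I]
    simp
  have hspec : -1 ∉ spectrum ℂ ((expUnitary (α • o) * u : unitary A) : A) := by
    intro hmem
    refine hα ?_
    rw [Submonoid.coe_mul, hexp, smul_mul_assoc, one_mul] at hmem
    rw [spectrum.mem_iff] at hmem ⊢
    refine fun hu ↦ hmem ?_
    have hne : Complex.exp (α * Complex.I) ≠ 0 := Complex.exp_ne_zero _
    convert hu.smul (Units.mk0 _ hne) using 1
    rw [smul_sub]
    congr 1
    rw [Algebra.algebraMap_eq_smul_one, Algebra.algebraMap_eq_smul_one, Units.smul_def, smul_smul]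
    simp [f, ← Complex.exp_add]
  have hlt := (Unitary.norm_sub_one_lt_two_iff (expUnitary (α • o) * u).2).2 hspec
  have hmem : expUnitary (α • o) * u ∈ G := by
    rw [← expUnitary_argSelfAdjoint hlt]
    exact key _
  exact (Subgroup.mul_mem_cancel_left _ (key _)).1 hmem

end Generators

/-! ### Product operators and the matrices of placed gates -/

section Tensor

open Matrix Function

variable {n : ℕ}

/-- The tensor product of one-qubit operators. -/
def tensor (A : Fin n → Matrix (Fin 2) (Fin 2) ℂ) : Operator n :=
  Matrix.of fun x y ↦ ∏ j, A j (x j) (y j)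

theorem tensor_apply (A : Fin n → Matrix (Fin 2) (Fin 2) ℂ) (x y : Basis n) :
    tensor A x y = ∏ j, A j (x j) (y j) := rfl

theorem tensor_mul (A B : Fin n → Matrix (Fin 2) (Fin 2) ℂ) :
    tensor A * tensor B = tensor (A * B) := by
  ext x y
  simp only [Matrix.mul_apply, tensor_apply, Pi.mul_apply, ← Finset.prod_mul_distrib]
  rw [Finset.prod_univ_sum, Fintype.piFinset_univ]

theorem tensor_one : tensor (1 : Fin n → Matrix (Fin 2) (Fin 2) ℂ) = 1 := by
  ext x y
  simp [tensor_apply, Matrix.one_apply, Finset.prod_boole, funext_iff]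

theorem star_tensor (A : Fin n → Matrix (Fin 2) (Fin 2) ℂ) :
    star (tensor A) = tensor (star A) := by
  ext x y
  simp [tensor_apply, Matrix.star_apply]

theorem tensor_update_apply (A : Fin n → Matrix (Fin 2) (Fin 2) ℂ) (k : Fin n)
    (B : Matrix (Fin 2) (Fin 2) ℂ) (x y : Basis n) :
    tensor (update A k B) x y
      = B (x k) (y k) * ∏ j ∈ Finset.univ.erase k, A j (x j) (y j) := by
  rw [tensor_apply, ← Finset.mul_prod_erase _ _ (Finset.mem_univ k), update_self]
  congr 1
  exact Finset.prod_congr rfl fun j hj ↦ by rw [update_of_ne (Finset.ne_of_mem_erase hj)]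

/-- The tensor product as a linear function of the factor at one qubit. -/
def tensorUpdate (A : Fin n → Matrix (Fin 2) (Fin 2) ℂ) (k : Fin n) :
    Matrix (Fin 2) (Fin 2) ℂ →ₗ[ℂ] Operator n where
  toFun B := tensor (update A k B)
  map_add' B C := by
    ext x y
    simp [tensor_update_apply, add_mul]
  map_smul' c B := by
    ext x y
    simp [tensor_update_apply, mul_assoc]

theorem tensorUpdate_apply (A : Fin n → Matrix (Fin 2) (Fin 2) ℂ) (k : Fin n)
    (B : Matrix (Fin 2) (Fin 2) ℂ) : tensorUpdate A k B = tensor (update A k B) := rfl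

theorem tensorUpdate_self (A : Fin n → Matrix (Fin 2) (Fin 2) ℂ) (k : Fin n) :
    tensorUpdate A k (A k) = tensor A := by
  rw [tensorUpdate_apply, update_eq_self]

theorem tensorUpdate_mul (A B : Fin n → Matrix (Fin 2) (Fin 2) ℂ) (k : Fin n)
    (C D : Matrix (Fin 2) (Fin 2) ℂ) :
    tensorUpdate A k C * tensorUpdate B k D = tensorUpdate (A * B) k (C * D) := by
  simp only [tensorUpdate_apply, tensor_mul]
  congr 1
  ext j : 1
  obtain rfl | hj := eq_or_ne j k
  · simp
  · simp [hj]

theorem star_tensorUpdate (A : Fin n → Matrix (Fin 2) (Fin 2) ℂ) (k : Fin n)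
    (C : Matrix (Fin 2) (Fin 2) ℂ) :
    star (tensorUpdate A k C) = tensorUpdate (star A) k (star C) := by
  simp only [tensorUpdate_apply, star_tensor]
  congr 1
  ext j : 1
  obtain rfl | hj := eq_or_ne j k
  · simp
  · simp [hj]

theorem tensorUpdate_one_one (k : Fin n) :
    tensorUpdate (1 : Fin n → Matrix (Fin 2) (Fin 2) ℂ) k 1 = 1 := by
  rw [← tensor_one]
  exact tensorUpdate_self 1 k

theorem applyOn_one_qubit (w : Fin 1 ↪ Fin n) (A : Matrix (Fin 2) (Fin 2) ℂ) :
    applyOn w (A.submatrix (Equiv.funUnique (Fin 1) (Fin 2)) (Equiv.funUnique (Fin 1) (Fin 2)))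
      = tensorUpdate 1 (w 0) A := by
  ext x y
  rw [tensorUpdate_apply, tensor_update_apply]
  simp only [Pi.one_apply, Matrix.one_apply, Finset.prod_boole]
  have h : (∀ j : Fin n, j ∉ Set.range w → x j = y j)
      ↔ ∀ j ∈ Finset.univ.erase (w 0), x j = y j := by
    refine forall_congr' fun j ↦ ?_
    simp [Fin.exists_fin_one, eq_comm]
  simp [applyOn, mul_ite, eq_comm (a := w 0)]

/-- The sign of the controlled `Z` on the qubits `j` and `k`. -/
def controlledSign (j k : Fin n) (x : Basis n) : ℂ := if x j = 1 ∧ x k = 1 then -1 else 1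

theorem controlledZ_submatrix : controlledZ.submatrix twoQubitOrder twoQubitOrder
    = Matrix.diagonal (controlledSign (0 : Fin 2) 1) := by
  have h : controlledZ = Matrix.diagonal ![1, 1, 1, -1] := by
    ext i j; fin_cases i <;> fin_cases j <;> rfl
  rw [h, Matrix.submatrix_diagonal_equiv]
  congr 1
  ext x
  obtain ⟨⟨a, b⟩, rfl⟩ := (finTwoArrowEquiv (Fin 2)).symm.surjective x
  fin_cases a <;> fin_cases b <;> simp [twoQubitOrder, controlledSign, finProdFinEquiv]

theorem applyOn_controlledZ (w : Fin 2 ↪ Fin n) :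
    applyOn w (controlledZ.submatrix twoQubitOrder twoQubitOrder)
      = Matrix.diagonal (controlledSign (w 0) (w 1)) := by
  rw [controlledZ_submatrix]
  ext x y
  by_cases hxy : x = y
  · subst hxy
    simp [applyOn, controlledSign]
  · rw [Matrix.diagonal_apply_ne _ hxy]
    simp only [applyOn, Matrix.of_apply, ite_eq_right_iff]
    intro h
    refine Matrix.diagonal_apply_ne _ fun hw ↦ hxy (funext fun j ↦ ?_)
    by_cases hj : j ∈ Set.range w
    · obtain ⟨i, rfl⟩ := hj
      exact congrFun hw i
    · exact h j hj

/-- The Pauli matrix `σ_x`. -/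
def sigmaX : Matrix (Fin 2) (Fin 2) ℂ := !![0, 1; 1, 0]

/-- The Pauli matrix `σ_z`. -/
def sigmaZ : Matrix (Fin 2) (Fin 2) ℂ := !![1, 0; 0, -1]

/-- Since σ_x flips bit j and bit k is kept, exactly one of the two controlled signs is active when
bit k is 1. Their product is the sign of σ_z on k. -/
theorem controlledZ_conj_tensor (A : Fin n → Matrix (Fin 2) (Fin 2) ℂ) {j k : Fin n}
    (hjk : j ≠ k) (hj : A j = sigmaX) (hk : A k = 1) :
    Matrix.diagonal (controlledSign j k) * tensor A * star (Matrix.diagonal (controlledSign j k))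
      = tensorUpdate A k sigmaZ := by
  ext x y
  have hA := tensor_update_apply A k (A k) x y
  rw [update_eq_self] at hA
  rw [Matrix.star_eq_conjTranspose, Matrix.diagonal_conjTranspose, Matrix.mul_diagonal,
    Matrix.diagonal_mul, tensorUpdate_apply, hA, tensor_update_apply, hk,
    ← Finset.mul_prod_erase (Finset.univ.erase k) _ (Finset.mem_erase.2 ⟨hjk, Finset.mem_univ j⟩),
    hj]
  simp only [controlledSign, Pi.star_apply, sigmaX, sigmaZ]
  generalize x j = a, y j = b, x k = c, y k = d
  fin_cases a <;> fin_cases b <;> fin_cases c <;> fin_cases d <;> simp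

end Tensor

/-! ### One-qubit computations: HT as an irrational rotation, and its action on Pauli matrices -/

section OneQubit

open Matrix

theorem exp_I_mul_pi_div_four :
    Complex.exp (Complex.I * Real.pi / 4) = (Real.sqrt 2 : ℂ) / 2 * (1 + Complex.I) := by
  have h : Complex.I * Real.pi / 4 = ((Real.pi / 4 : ℝ) : ℂ) * Complex.I := by push_cast; ring
  rw [h, Complex.exp_mul_I, ← Complex.ofReal_cos, ← Complex.ofReal_sin, Real.cos_pi_div_four,
    Real.sin_pi_div_four]
  push_cast
  ring

theorem sqrt_two_mul_sqrt_two : (Real.sqrt 2 : ℂ) * Real.sqrt 2 = 2 := by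
  rw [← Complex.ofReal_mul, Real.mul_self_sqrt (by norm_num)]; norm_num

theorem hadamard_mul_phaseT : hadamard * phaseT =
    !![(Real.sqrt 2 : ℂ) / 2, (1 + Complex.I) / 2; (Real.sqrt 2 : ℂ) / 2, -(1 + Complex.I) / 2] := by
  have h := sqrt_two_mul_sqrt_two
  have h0 : (Real.sqrt 2 : ℂ) ≠ 0 := by
    intro h1; rw [h1] at h; norm_num at h
  have h2 : 1 / (Real.sqrt 2 : ℂ) = Real.sqrt 2 / 2 := by
    field_simp; linear_combination -h
  rw [hadamard, phaseT, exp_I_mul_pi_div_four, h2]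
  ext i j
  fin_cases i <;> fin_cases j <;> simp [Matrix.mul_apply, Fin.sum_univ_two]
  · linear_combination ((1 + Complex.I) / 4) * h
  · linear_combination (-(1 + Complex.I) / 4) * h

theorem star_hadamard_mul_phaseT : star (hadamard * phaseT) =
    !![(Real.sqrt 2 : ℂ) / 2, (Real.sqrt 2 : ℂ) / 2; (1 - Complex.I) / 2, -(1 - Complex.I) / 2] := by
  rw [hadamard_mul_phaseT]
  ext i j
  fin_cases i <;> fin_cases j <;>
    simp [Matrix.star_apply, sub_eq_add_neg, add_comm]

theorem star_sigmaY : star sigmaY = sigmaY := by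
  ext i j
  fin_cases i <;> fin_cases j <;> simp [sigmaY, Matrix.star_apply]

/-- At rational multiples of π, twice the cosine is an algebraic integer. -/
theorem irrational_div_pi_of_two_mul_cos {θ : ℝ} (h : ¬ IsIntegral ℤ (2 * Real.cos θ)) :
    Irrational (θ / Real.pi) := by
  rintro ⟨q, hq⟩
  refine h ?_
  have := Real.isIntegral_two_mul_cos_rat_mul_pi q
  rwa [hq, div_mul_cancel₀ _ Real.pi_ne_zero] at this

/-- The square of the number is 1 - √2/2. Subtracting this from 1 and squaring gives 1/2, a rational
number that is not an integer. -/
theorem not_isIntegral_sqrt_two_mul_sin_pi_div_eight :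
    ¬ IsIntegral ℤ (2 * (Real.sqrt 2 / 2 * Real.sin (Real.pi / 8))) := by
  intro h
  have hs : Real.sin (Real.pi / 8) ^ 2 = 1 / 2 - Real.sqrt 2 / 4 := by
    have := Real.cos_two_mul' (Real.pi / 8)
    rw [show 2 * (Real.pi / 8) = Real.pi / 4 by ring, Real.cos_pi_div_four] at this
    linarith [Real.sin_sq_add_cos_sq (Real.pi / 8)]
  have h2 : Real.sqrt 2 ^ 2 = 2 := Real.sq_sqrt (by norm_num)
  have h1 : (2 * (Real.sqrt 2 / 2 * Real.sin (Real.pi / 8))) ^ 2 = 1 - Real.sqrt 2 / 2 := by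
    linear_combination Real.sin (Real.pi / 8) ^ 2 * h2 + 2 * hs
  have h3 : IsIntegral ℤ ((1 - (1 - Real.sqrt 2 / 2)) ^ 2) :=
    (isIntegral_one.sub (h1 ▸ h.pow 2)).pow 2
  have h4 : (1 - (1 - Real.sqrt 2 / 2)) ^ 2 = ((1 / 2 : ℚ) : ℝ) := by
    push_cast; linear_combination h2 / 4
  rw [h4] at h3
  obtain ⟨k, hk⟩ := (IsIntegral.exists_int_iff_exists_rat h3).1 ⟨_, rfl⟩
  have hk' : (1 : ℤ) = 2 * k := by
    have : (1 : ℝ) = 2 * k := by rw [← hk]; push_cast; norm_num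
    exact_mod_cast this
  omega

/-- The axis is K = m(cσ_x - sσ_y + cσ_z) with c, s the cosine and sine of π/8. Conjugation by σ_y
negates the σ_x and σ_z parts, so only -2ms σ_y survives in the sum. -/
theorem exists_hadamard_mul_phaseT_eq_rotation :
    ∃ (z : ℂ) (θ : ℝ) (K : Matrix (Fin 2) (Fin 2) ℂ) (c : ℝ), ‖z‖ = 1 ∧ Irrational (θ / Real.pi) ∧
      K ∈ selfAdjoint (Matrix (Fin 2) (Fin 2) ℂ) ∧ K * K = 1 ∧
      hadamard * phaseT = z • ((Real.cos θ : ℂ) • 1 + (Real.sin θ * Complex.I : ℂ) • K) ∧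
      c ≠ 0 ∧ K + sigmaY * K * star sigmaY = c • sigmaY := by
  set c := Real.cos (Real.pi / 8) with hc
  set s := Real.sin (Real.pi / 8) with hs
  have hs0 : s ≠ 0 := (Real.sin_pos_of_pos_of_lt_pi (by positivity)
    (by linarith [Real.pi_pos])).ne'
  have hcs : s ^ 2 + c ^ 2 = 1 := Real.sin_sq_add_cos_sq _
  have h2 : Real.sqrt 2 ^ 2 = 2 := Real.sq_sqrt (by norm_num)
  have h8 : c ^ 2 - s ^ 2 = Real.sqrt 2 / 2 := by
    rw [← Real.cos_pi_div_four, show Real.pi / 4 = 2 * (Real.pi / 8) by ring, Real.cos_two_mul']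
  have h8' : 2 * s * c = Real.sqrt 2 / 2 := by
    rw [← Real.sin_pi_div_four, show Real.pi / 4 = 2 * (Real.pi / 8) by ring, Real.sin_two_mul]
  -- Half the trace of HT once the phase z is divided out, hence the cosine of the rotation angle.
  let a := Real.sqrt 2 / 2 * s
  have ha2 : a ^ 2 = s ^ 2 / 2 := by linear_combination s ^ 2 / 4 * h2
  have ha : -1 ≤ a ∧ a ≤ 1 := abs_le.1 (abs_le_one_iff_mul_self_le_one.2 (by nlinarith))
  let θ := Real.arccos a
  have hcos : Real.cos θ = a := Real.cos_arccos ha.1 ha.2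
  have hsin2 : Real.sin θ ^ 2 = 1 - s ^ 2 / 2 := by rw [Real.sin_sq, hcos, ha2]
  have hsin : Real.sin θ ≠ 0 := by
    intro h
    rw [h] at hsin2
    nlinarith
  -- Normalises the axis: L² is the scalar 2c² + s² = 2 - s².
  let m := Real.sqrt 2 / 2 / Real.sin θ
  have hm : Real.sin θ * m = Real.sqrt 2 / 2 := by simp only [m]; field_simp
  have hm2 : m ^ 2 * (2 - s ^ 2) = 1 := by
    simp only [m]
    rw [div_pow, hsin2, div_mul_eq_mul_div, div_eq_one_iff_eq (by nlinarith)]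
    linear_combination (2 - s ^ 2) / 4 * h2
  have hm0 : m ≠ 0 := by rintro h; rw [h] at hm2; norm_num at hm2
  let L : Matrix (Fin 2) (Fin 2) ℂ := !![(c : ℂ), c + s * Complex.I; c - s * Complex.I, -c]
  have hcsC : (s : ℂ) ^ 2 + (c : ℂ) ^ 2 = 1 := by exact_mod_cast hcs
  -- The phase is a square root of det(HT) = -exp(iπ/4).
  refine ⟨-Complex.I * (c + s * Complex.I), θ, (m : ℂ) • L, -2 * m * s, ?_, ?_, ?_, ?_, ?_, ?_, ?_⟩
  · have : (c + s * Complex.I : ℂ) = Complex.exp ((Real.pi / 8 : ℝ) * Complex.I) := by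
      rw [Complex.exp_mul_I, ← Complex.ofReal_cos, ← Complex.ofReal_sin]
    rw [this, norm_mul, Complex.norm_exp_ofReal_mul_I]
    simp
  · apply irrational_div_pi_of_two_mul_cos
    rw [hcos]
    exact not_isIntegral_sqrt_two_mul_sin_pi_div_eight
  · rw [selfAdjoint.mem_iff]
    ext i j
    fin_cases i <;> fin_cases j <;> simp [L, Matrix.star_apply, sub_eq_add_neg]
  · have hm2C : (m : ℂ) ^ 2 * (2 - (s : ℂ) ^ 2) = 1 := by exact_mod_cast hm2
    ext i j
    fin_cases i <;> fin_cases j <;> simp [L, Matrix.mul_apply, Fin.sum_univ_two]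
    · linear_combination hm2C + 2 * m ^ 2 * hcsC - m ^ 2 * s ^ 2 * Complex.I_sq
    · ring
    · ring
    · linear_combination hm2C + 2 * m ^ 2 * hcsC - m ^ 2 * s ^ 2 * Complex.I_sq
  · have h : (Real.cos θ : ℂ) • (1 : Matrix (Fin 2) (Fin 2) ℂ)
        + (Real.sin θ * Complex.I : ℂ) • (m : ℂ) • L
        = ((Real.sqrt 2 : ℂ) / 2) • ((s : ℂ) • 1 + Complex.I • L) := by
      have hmC : (Real.sin θ : ℂ) * m = Real.sqrt 2 / 2 := by exact_mod_cast hm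
      rw [hcos, smul_add, smul_smul, smul_smul, smul_smul, mul_right_comm, hmC]
      simp [a]
    have h2C : (Real.sqrt 2 : ℂ) ^ 2 = 2 := by exact_mod_cast h2
    have h8C : (c : ℂ) ^ 2 - (s : ℂ) ^ 2 = Real.sqrt 2 / 2 := by exact_mod_cast h8
    have h8C' : 2 * (s : ℂ) * c = Real.sqrt 2 / 2 := by exact_mod_cast h8'
    rw [h, hadamard_mul_phaseT]
    ext i j
    fin_cases i <;> fin_cases j <;> simp [L]
    · linear_combination (Real.sqrt 2 / 2 * (Complex.I * c * s + c ^ 2 + s ^ 2)) * Complex.I_sq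
        - Real.sqrt 2 / 2 * hcsC
    · linear_combination (Real.sqrt 2 / 2 * (c + s * Complex.I) ^ 2 - Real.sqrt 2 / 2 * s ^ 2)
        * Complex.I_sq - Real.sqrt 2 / 2 * h8C - Real.sqrt 2 / 2 * Complex.I * h8C'
        - (1 + Complex.I) / 4 * h2C
    · linear_combination (Real.sqrt 2 / 2 * (c ^ 2 - s ^ 2 * (Complex.I ^ 2 - 1))) * Complex.I_sq
        - Real.sqrt 2 / 2 * hcsC
    · linear_combination -(Real.sqrt 2 / 2 * (Complex.I * c * s + c ^ 2 - s ^ 2)) * Complex.I_sq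
        + Real.sqrt 2 / 2 * h8C + Real.sqrt 2 / 2 * Complex.I * h8C' + (1 + Complex.I) / 4 * h2C
  · simp [hm0, hs0]
  · rw [star_sigmaY]
    ext i j
    fin_cases i <;> fin_cases j <;>
      simp [L, sigmaY]
    · linear_combination m * c * Complex.I_sq
    · linear_combination m * (c - s * Complex.I) * Complex.I_sq
    · linear_combination m * (c + s * Complex.I) * Complex.I_sq
    · linear_combination -(m * c) * Complex.I_sq

/-- Conjugation by HT sends Z to X, X to (Z - Y)/√2 and Y to -(Y + Z)/√2. Linear combinations of the
images always recover Z, and Z yields the rest. -/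
theorem pauli_mem_of_conj_invariant {V : Submodule ℝ (Matrix (Fin 2) (Fin 2) ℂ)}
    (hV : ∀ B ∈ V, hadamard * phaseT * B * star (hadamard * phaseT) ∈ V)
    (h : sigmaX ∈ V ∨ sigmaY ∈ V ∨ sigmaZ ∈ V) : sigmaX ∈ V ∧ sigmaY ∈ V ∧ sigmaZ ∈ V := by
  have h2 := sqrt_two_mul_sqrt_two
  have hI := Complex.I_sq
  have hZ : hadamard * phaseT * sigmaZ * star (hadamard * phaseT) = sigmaX := by
    rw [star_hadamard_mul_phaseT, hadamard_mul_phaseT]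
    ext i j
    fin_cases i <;> fin_cases j <;>
      simp [sigmaX, sigmaZ, Matrix.mul_apply, Fin.sum_univ_two]
    · linear_combination h2 / 4 + hI / 4
    · linear_combination h2 / 4 - hI / 4
    · linear_combination h2 / 4 - hI / 4
    · linear_combination h2 / 4 + hI / 4
  have hX : hadamard * phaseT * sigmaX * star (hadamard * phaseT)
      = (Real.sqrt 2 / 2) • (sigmaZ - sigmaY) := by
    rw [star_hadamard_mul_phaseT, hadamard_mul_phaseT]
    ext i j
    fin_cases i <;> fin_cases j <;>
      simp [sigmaX, sigmaY, sigmaZ, Matrix.mul_apply, Fin.sum_univ_two]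
    · ring
    · ring
    · ring
    · ring
  have hY : hadamard * phaseT * sigmaY * star (hadamard * phaseT)
      = -(Real.sqrt 2 / 2) • (sigmaY + sigmaZ) := by
    rw [star_hadamard_mul_phaseT, hadamard_mul_phaseT]
    ext i j
    fin_cases i <;> fin_cases j <;>
      simp [sigmaY, sigmaZ, Matrix.mul_apply, Fin.sum_univ_two]
    · linear_combination (Real.sqrt 2 / 2) * hI
    · ring
    · ring
    · linear_combination (-(Real.sqrt 2) / 2) * hI
  have hr : Real.sqrt 2 / 2 ≠ 0 := by positivity
  have hZX (h : sigmaZ ∈ V) : sigmaX ∈ V := hZ ▸ hV _ h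
  have hXd (h : sigmaX ∈ V) : sigmaZ - sigmaY ∈ V :=
    (V.smul_mem_iff hr).1 (hX ▸ hV _ h)
  have hYd (h : sigmaY ∈ V) : sigmaY + sigmaZ ∈ V :=
    (V.smul_mem_iff (neg_ne_zero.2 hr)).1 (hY ▸ hV _ h)
  have hZall (h : sigmaZ ∈ V) : sigmaX ∈ V ∧ sigmaY ∈ V ∧ sigmaZ ∈ V :=
    ⟨hZX h, by simpa using V.sub_mem h (hXd (hZX h)), h⟩
  rcases h with h | h | h
  · have hd := hV _ (hXd h)
    rw [mul_sub, sub_mul, hZ, hY, neg_smul, sub_neg_eq_add] at hd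
    have hs := (V.smul_mem_iff hr).1 (by simpa only [add_sub_cancel_left] using V.sub_mem hd h)
    have hz := V.add_mem hs (hXd h)
    rw [show sigmaY + sigmaZ + (sigmaZ - sigmaY) = (2 : ℝ) • sigmaZ by rw [two_smul]; abel] at hz
    exact hZall ((V.smul_mem_iff two_ne_zero).1 hz)
  · exact hZall (by simpa using V.sub_mem (hYd h) h)
  · exact hZall h

end OneQubit

/-! ### Pauli strings generate the full unitary group -/

section Universality

open Matrix Function selfAdjoint
open scoped Matrix.Norms.L2Operator

variable {n : ℕ} {G : Subgroup (QUnitary n)} {hG : IsClosed (G : Set (QUnitary n))}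

/-- The one-qubit factors at `k` that complete `A` to a generator of `G`. -/
noncomputable def factorGenerators (G : Subgroup (QUnitary n))
    (hG : IsClosed (G : Set (QUnitary n)))
    (A : Fin n → Matrix (Fin 2) (Fin 2) ℂ) (k : Fin n) :
    Submodule ℝ (Matrix (Fin 2) (Fin 2) ℂ) :=
  (generators G hG).comap ((tensorUpdate A k).restrictScalars ℝ)

theorem mem_factorGenerators {A : Fin n → Matrix (Fin 2) (Fin 2) ℂ} {k : Fin n}
    {B : Matrix (Fin 2) (Fin 2) ℂ} :
    B ∈ factorGenerators G hG A k ↔ tensorUpdate A k B ∈ generators G hG := Iff.rfl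

/-- A gate on qubit k alone leaves the other factors of a string unchanged, so one-qubit arguments
apply inside any string. -/
theorem conj_mem_factorGenerators {A : Fin n → Matrix (Fin 2) (Fin 2) ℂ} {k : Fin n}
    {u B : Matrix (Fin 2) (Fin 2) ℂ} (hu : ∃ g ∈ G, (g : Operator n) = tensorUpdate 1 k u)
    (hB : B ∈ factorGenerators G hG A k) : u * B * star u ∈ factorGenerators G hG A k := by
  obtain ⟨g, hg, hgu⟩ := hu
  have h := conj_mem_generators hg (mem_factorGenerators.1 hB)
  rw [hgu, star_tensorUpdate, tensorUpdate_mul, tensorUpdate_mul] at h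
  rw [mem_factorGenerators]
  simpa only [one_mul, star_one, mul_one] using h

theorem one_mem_generators (hph : ∀ z : ℂ, ‖z‖ = 1 → ∃ g ∈ G, (g : Operator n) = z • 1) :
    1 ∈ generators G hG := by
  refine ⟨.one _, fun t ↦ ?_⟩
  obtain ⟨g, hg, hgz⟩ := hph (Complex.exp (t * Complex.I)) (Complex.norm_exp_ofReal_mul_I t)
  convert hg
  ext1
  rw [hgz, expUnitary_smul_of_sq_eq_one _ (one_mul 1), ← add_smul, Complex.exp_mul_I]
  simp

theorem neg_one_mem (hph : ∀ z : ℂ, ‖z‖ = 1 → ∃ g ∈ G, (g : Operator n) = z • 1) :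
    (-1 : QUnitary n) ∈ G := by
  obtain ⟨g, hg, hgz⟩ := hph (-1) (by simp)
  convert hg
  ext1
  rw [hgz, neg_one_smul]
  rfl

theorem sigmaY_mem_factorGenerators (k : Fin n)
    (hph : ∀ z : ℂ, ‖z‖ = 1 → ∃ g ∈ G, (g : Operator n) = z • 1)
    (hHT : ∃ g ∈ G, (g : Operator n) = tensorUpdate 1 k (hadamard * phaseT))
    (hY : ∃ g ∈ G, (g : Operator n) = tensorUpdate 1 k sigmaY) :
    sigmaY ∈ factorGenerators G hG 1 k := by
  obtain ⟨z, θ, K, c, hz, hθ, hK, hKK, hrot, hc, hsum⟩ := exists_hadamard_mul_phaseT_eq_rotation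
  have hK' : tensorUpdate 1 k K ∈ selfAdjoint (Operator n) := by
    rw [selfAdjoint.mem_iff] at hK ⊢
    rw [star_tensorUpdate, star_one, hK]
  have hKK' : tensorUpdate 1 k K * tensorUpdate 1 k K = (1 : Operator n) := by
    rw [tensorUpdate_mul, hKK, one_mul, tensorUpdate_one_one]
  have hmem : K ∈ factorGenerators G hG 1 k := by
    refine mem_generators_of_irrational (hG := hG) hK' hKK' hθ (neg_one_mem hph) ?_
    obtain ⟨g, hg, hgu⟩ := hHT
    obtain ⟨p, hp, hpz⟩ := hph z hz
    have h : g = p * expUnitary (θ • ⟨_, hK'⟩) := by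
      ext1
      rw [Submonoid.coe_mul, hpz, hgu, expUnitary_smul_of_sq_eq_one _ hKK', hrot, map_smul,
        map_add, map_smul, map_smul, tensorUpdate_one_one, smul_mul_assoc, one_mul]
    rw [h] at hg
    exact (Subgroup.mul_mem_cancel_left _ hp).1 hg
  have h := Submodule.add_mem _ hmem (conj_mem_factorGenerators hY hmem)
  rw [hsum] at h
  exact (Submodule.smul_mem_iff _ hc).1 h

/-- Induction on the support. A single qubit starts from σ_y; a new qubit k is attached to an old
one j by ΛZ. -/
theorem pauli_tensor_mem_generators
    (hph : ∀ z : ℂ, ‖z‖ = 1 → ∃ g ∈ G, (g : Operator n) = z • 1)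
    (hHT : ∀ k, ∃ g ∈ G, (g : Operator n) = tensorUpdate 1 k (hadamard * phaseT))
    (hY : ∀ k, ∃ g ∈ G, (g : Operator n) = tensorUpdate 1 k sigmaY)
    (hZ : ∀ j k, j ≠ k → ∃ g ∈ G, (g : Operator n) = Matrix.diagonal (controlledSign j k))
    (S : Finset (Fin n)) (A : Fin n → Matrix (Fin 2) (Fin 2) ℂ)
    (hS : ∀ j ∈ S, A j = sigmaX ∨ A j = sigmaY ∨ A j = sigmaZ) (hS' : ∀ j ∉ S, A j = 1) :
    tensor A ∈ generators G hG := by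
  have hpauli (A : Fin n → Matrix (Fin 2) (Fin 2) ℂ) (k : Fin n)
      (h : sigmaX ∈ factorGenerators G hG A k ∨ sigmaY ∈ factorGenerators G hG A k ∨
        sigmaZ ∈ factorGenerators G hG A k) {B : Matrix (Fin 2) (Fin 2) ℂ}
      (hB : B = sigmaX ∨ B = sigmaY ∨ B = sigmaZ) : tensorUpdate A k B ∈ generators G hG := by
    obtain ⟨hx, hy, hz⟩ :=
      pauli_mem_of_conj_invariant (fun B hB ↦ conj_mem_factorGenerators (hHT k) hB) h
    rcases hB with rfl | rfl | rfl
    exacts [hx, hy, hz]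
  induction S using Finset.induction_on generalizing A with
  | empty =>
    have : A = 1 := funext fun j ↦ hS' j (Finset.notMem_empty j)
    rw [this, tensor_one]
    exact one_mem_generators hph
  | insert k S hk ih =>
    obtain rfl | ⟨j, hj⟩ := S.eq_empty_or_nonempty
    · have hA : tensor A = tensorUpdate 1 k (A k) := by
        rw [tensorUpdate_apply]
        congr 1
        refine eq_update_iff.2 ⟨rfl, fun i hi ↦ hS' i (by simpa using hi)⟩
      rw [hA]
      exact hpauli 1 k (.inr (.inl (sigmaY_mem_factorGenerators k hph (hHT k) (hY k))))
        (hS k (by simp))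
    · have hjk : j ≠ k := fun h ↦ hk (h ▸ hj)
      -- The factor at j is made σ_x so that ΛZ creates σ_z at k; afterwards the factors at k and
      -- then j are changed to the desired ones.
      have h1 : tensor (update (update A j sigmaX) k 1) ∈ generators G hG := by
        refine ih _ (fun i hi ↦ ?_) (fun i hi ↦ ?_)
        · rw [update_of_ne (ne_of_mem_of_not_mem hi hk)]
          obtain rfl | hij := eq_or_ne i j
          · simp
          · rw [update_of_ne hij]
            exact hS i (Finset.mem_insert_of_mem hi)
        · obtain rfl | hik := eq_or_ne i k
          · simp
          · rw [update_of_ne hik, update_of_ne (ne_of_mem_of_not_mem hj hi).symm]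
            exact hS' i (by simp [hik, hi])
      obtain ⟨g, hg, hgz⟩ := hZ j k hjk
      have h2 := conj_mem_generators hg h1
      rw [hgz, controlledZ_conj_tensor _ hjk (by simp [hjk]) (by simp), tensorUpdate_apply,
        update_idem, ← tensorUpdate_apply] at h2
      have h3 := hpauli _ k (.inr (.inr h2)) (hS k (by simp))
      rw [tensorUpdate_apply, update_comm hjk, update_eq_self, ← tensorUpdate_apply] at h3
      rw [← tensorUpdate_self A j]
      exact hpauli _ j (.inl h3) (hS j (Finset.mem_insert_of_mem hj))

/-- The operators all of whose complex multiples have their Hermitian part in `V`. -/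
def hermitianPartIn (V : Submodule ℝ (Operator n)) : Submodule ℂ (Operator n) where
  carrier := {M | ∀ c : ℂ, c • M + star (c • M) ∈ V}
  zero_mem' c := by simp
  add_mem' {M N} hM hN c := by
    have h := V.add_mem (hM c) (hN c)
    rw [smul_add, star_add]
    convert h using 1
    abel
  smul_mem' a M hM c := by
    rw [smul_smul]
    exact hM _

theorem mem_hermitianPartIn_of_isSelfAdjoint {V : Submodule ℝ (Operator n)} {M : Operator n}
    (h : IsSelfAdjoint M) (hM : M ∈ V) : M ∈ hermitianPartIn V := by
  intro c
  have : c • M + star (c • M) = (2 * c.re) • M := by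
    rw [star_smul, h.star_eq, ← add_smul, ← Complex.coe_smul (2 * c.re) M]
    congr 1
    exact Complex.add_conj c
  rw [this]
  exact V.smul_mem _ hM

theorem matrix_two_eq_pauli_sum (B : Matrix (Fin 2) (Fin 2) ℂ) :
    B = ((B 0 0 + B 1 1) / 2) • (1 : Matrix (Fin 2) (Fin 2) ℂ) + ((B 0 1 + B 1 0) / 2) • sigmaX
      + (Complex.I * (B 0 1 - B 1 0) / 2) • sigmaY + ((B 0 0 - B 1 1) / 2) • sigmaZ := by
  ext i j
  fin_cases i <;> fin_cases j <;> simp [sigmaX, sigmaY, sigmaZ]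
  · ring
  · linear_combination ((B 0 1 - B 1 0) / 2) * Complex.I_sq
  · linear_combination -((B 0 1 - B 1 0) / 2) * Complex.I_sq
  · ring

theorem tensor_mem_of_pauli {W : Submodule ℂ (Operator n)}
    (h : ∀ A : Fin n → Matrix (Fin 2) (Fin 2) ℂ,
      (∀ j, A j = 1 ∨ A j = sigmaX ∨ A j = sigmaY ∨ A j = sigmaZ) → tensor A ∈ W)
    (A : Fin n → Matrix (Fin 2) (Fin 2) ℂ) : tensor A ∈ W := by
  -- `S` holds the qubits whose factor is still arbitrary; each is expanded in the Pauli basis in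
  -- turn.
  suffices H : ∀ (S : Finset (Fin n)) (A : Fin n → Matrix (Fin 2) (Fin 2) ℂ),
      (∀ j ∉ S, A j = 1 ∨ A j = sigmaX ∨ A j = sigmaY ∨ A j = sigmaZ) → tensor A ∈ W from
    H Finset.univ A fun j hj ↦ absurd (Finset.mem_univ j) hj
  intro S
  induction S using Finset.induction_on with
  | empty => exact fun A hA ↦ h A fun j ↦ hA j (Finset.notMem_empty j)
  | insert k S hk ih =>
    intro A hA
    have hupd {P : Matrix (Fin 2) (Fin 2) ℂ}
        (hP : P = 1 ∨ P = sigmaX ∨ P = sigmaY ∨ P = sigmaZ) : tensorUpdate A k P ∈ W := by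
      refine ih _ fun j hj ↦ ?_
      obtain rfl | hjk := eq_or_ne j k
      · simpa using hP
      · rw [update_of_ne hjk]
        exact hA j (by simp [hjk, hj])
    rw [← tensorUpdate_self A k, matrix_two_eq_pauli_sum (A k)]
    simp only [map_add, map_smul]
    refine W.add_mem (W.add_mem (W.add_mem ?_ ?_) ?_) ?_ <;>
      exact W.smul_mem _ (hupd (by simp))

theorem eq_top_of_tensor_mem {W : Submodule ℂ (Operator n)}
    (h : ∀ A : Fin n → Matrix (Fin 2) (Fin 2) ℂ, tensor A ∈ W) : W = ⊤ := by
  refine eq_top_iff.2 fun M _ ↦ ?_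
  rw [Matrix.matrix_eq_sum_single M]
  refine W.sum_mem fun x _ ↦ W.sum_mem fun y _ ↦ ?_
  have : Matrix.single x y (M x y) = M x y • tensor fun j ↦ Matrix.single (x j) (y j) (1 : ℂ) := by
    ext a b
    simp only [Matrix.single_apply, Matrix.smul_apply, tensor_apply, Finset.prod_boole,
      Finset.mem_univ, true_imp_iff, forall_and, funext_iff, smul_eq_mul, mul_ite, mul_one,
      mul_zero]
  rw [this]
  exact W.smul_mem _ (h _)

theorem pauli_isSelfAdjoint {P : Matrix (Fin 2) (Fin 2) ℂ}
    (h : P = 1 ∨ P = sigmaX ∨ P = sigmaY ∨ P = sigmaZ) : star P = P := by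
  rcases h with rfl | rfl | rfl | rfl
  · exact star_one _
  · ext i j
    fin_cases i <;> fin_cases j <;> simp [sigmaX, Matrix.star_apply]
  · exact star_sigmaY
  · ext i j
    fin_cases i <;> fin_cases j <;> simp [sigmaZ, Matrix.star_apply]

theorem eq_top_of_gates_mem (hG : IsClosed (G : Set (QUnitary n)))
    (hph : ∀ z : ℂ, ‖z‖ = 1 → ∃ g ∈ G, (g : Operator n) = z • 1)
    (hHT : ∀ k, ∃ g ∈ G, (g : Operator n) = tensorUpdate 1 k (hadamard * phaseT))
    (hY : ∀ k, ∃ g ∈ G, (g : Operator n) = tensorUpdate 1 k sigmaY)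
    (hZ : ∀ j k, j ≠ k → ∃ g ∈ G, (g : Operator n) = Matrix.diagonal (controlledSign j k)) :
    G = ⊤ := by
  have hW : hermitianPartIn (generators G hG) = ⊤ := by
    refine eq_top_of_tensor_mem (tensor_mem_of_pauli fun A hA ↦ ?_)
    refine mem_hermitianPartIn_of_isSelfAdjoint ?_ ?_
    · rw [IsSelfAdjoint, star_tensor]
      exact congrArg tensor (funext fun j ↦ pauli_isSelfAdjoint (hA j))
    · classical
      refine pauli_tensor_mem_generators hph hHT hY hZ (Finset.univ.filter fun j ↦ A j ≠ 1) A
        (fun j hj ↦ ?_) (fun j hj ↦ ?_)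
      · exact (hA j).resolve_left (by simpa using hj)
      · simpa using hj
  refine eq_top_of_generators (hG := hG) (fun u ↦ Matrix.finite_spectrum _) fun X hX ↦ ?_
  have hmem : X ∈ hermitianPartIn (generators G hG) := hW ▸ Submodule.mem_top
  -- For self-adjoint X, the coefficient 1/2 returns X itself.
  have h := hmem (1 / 2)
  rw [star_smul, (selfAdjoint.mem_iff.1 hX), ← add_smul] at h
  convert h
  norm_num

theorem compactSpace_unitaryGroup : CompactSpace (QUnitary n) := by
  have : ProperSpace (Operator n) := FiniteDimensional.proper ℂ _
  suffices IsCompact (Matrix.unitaryGroup (Basis n) ℂ : Set (Operator n)) from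
    isCompact_iff_compactSpace.1 this
  refine (isCompact_closedBall (0 : Operator n) 1).of_isClosed_subset ?_ fun u hu ↦ ?_
  · exact isClosed_unitary
  · rw [mem_closedBall_zero_iff]
    exact (CStarRing.norm_of_mem_unitary hu).le

end Universality

/-! ### Unitarity of placed gates and their membership in circuits -/

section Circuits

open Matrix
open scoped Matrix.Norms.L2Operator

variable {n : ℕ}

theorem tensorUpdate_one_mem_unitary {u : Matrix (Fin 2) (Fin 2) ℂ}
    (hu : u ∈ Matrix.unitaryGroup (Fin 2) ℂ) (k : Fin n) :
    tensorUpdate 1 k u ∈ Matrix.unitaryGroup (Basis n) ℂ := by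
  rw [Matrix.mem_unitaryGroup_iff] at hu ⊢
  rw [star_tensorUpdate, tensorUpdate_mul, hu, star_one, one_mul, tensorUpdate_one_one]

theorem diagonal_controlledSign_mem_unitary (j k : Fin n) :
    Matrix.diagonal (controlledSign j k) ∈ Matrix.unitaryGroup (Basis n) ℂ := by
  rw [Matrix.mem_unitaryGroup_iff, Matrix.star_eq_conjTranspose, Matrix.diagonal_conjTranspose,
    Matrix.diagonal_mul_diagonal, ← Matrix.diagonal_one]
  congr 1
  ext x
  simp only [controlledSign, Pi.star_apply]
  split_ifs <;> simp

theorem smul_one_mem_unitary {z : ℂ} (hz : ‖z‖ = 1) :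
    z • (1 : Operator n) ∈ Matrix.unitaryGroup (Basis n) ℂ := by
  rw [Matrix.mem_unitaryGroup_iff, star_smul, star_one, smul_mul_smul_comm, one_mul]
  have : z * star z = 1 := by
    rw [Complex.star_def, Complex.mul_conj, Complex.normSq_eq_norm_sq, hz]; norm_num
  rw [this, one_smul]

theorem tensorUpdate_mem_circuits {S : Set Gate} {u : Matrix (Fin 2) (Fin 2) ℂ}
    {hu : u ∈ Matrix.unitaryGroup (Fin 2) ℂ} (h : oneQubitGate u hu ∈ S) (k : Fin n) :
    tensorUpdate 1 k u ∈ circuits S n := by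
  let w : Fin 1 ↪ Fin n := ⟨fun _ ↦ k, fun _ _ _ ↦ Subsingleton.elim _ _⟩
  exact Submonoid.subset_closure ⟨_, h, w, (applyOn_one_qubit w u).symm⟩

theorem diagonal_controlledSign_mem_circuits {S : Set Gate}
    (h : twoQubitGate controlledZ controlledZ_mem ∈ S) {j k : Fin n} (hjk : j ≠ k) :
    Matrix.diagonal (controlledSign j k) ∈ circuits S n := by
  have hw : Function.Injective ![j, k] := by
    intro a b hab
    fin_cases a <;> fin_cases b <;> simp_all
  exact Submonoid.subset_closure ⟨_, h, ⟨![j, k], hw⟩, (applyOn_controlledZ ⟨![j, k], hw⟩).symm⟩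

end Circuits
end QubitCircuit

open scoped Matrix.Norms.L2Operator in
open QubitCircuit in
theorem theorem1 : QubitCircuit.ApproximatelyUniversal QubitCircuit.gateFamily := by
  intro n U δ hδ
  have := compactSpace_unitaryGroup (n := n)
  let s : Set (QUnitary n) :=
    {u | (∃ z : ℂ, ‖z‖ = 1 ∧ (u : Operator n) = z • 1) ∨ (u : Operator n) ∈ circuits gateFamily n}
  have htop : (Subgroup.closure s).topologicalClosure = ⊤ := by
    have hs (u : QUnitary n) (hu : u ∈ s) : u ∈ (Subgroup.closure s).topologicalClosure :=
      Subgroup.le_topologicalClosure _ (Subgroup.subset_closure hu)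
    refine eq_top_of_gates_mem (Subgroup.isClosed_topologicalClosure _) (fun z hz ↦ ?_)
      (fun k ↦ ?_) (fun k ↦ ?_) (fun j k hjk ↦ ?_)
    · exact ⟨⟨_, smul_one_mem_unitary hz⟩, hs _ (.inl ⟨z, hz, rfl⟩), rfl⟩
    · exact ⟨⟨_, tensorUpdate_one_mem_unitary (mul_mem hadamard_mem phaseT_mem) k⟩,
        hs _ (.inr (tensorUpdate_mem_circuits (.inl rfl) k)), rfl⟩
    · exact ⟨⟨_, tensorUpdate_one_mem_unitary sigmaY_mem k⟩,
        hs _ (.inr (tensorUpdate_mem_circuits (.inr (.inl rfl)) k)), rfl⟩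
    · exact ⟨⟨_, diagonal_controlledSign_mem_unitary j k⟩,
        hs _ (.inr (diagonal_controlledSign_mem_circuits (.inr (.inr rfl)) hjk)), rfl⟩
  have hU : U ∈ closure (Submonoid.closure s : Set (QUnitary n)) := by
    -- Compactness is used here: inverses are limits of positive powers.
    rw [closure_submonoidClosure_eq_closure_subgroupClosure, ← Subgroup.topologicalClosure_coe,
      htop]
    exact Set.mem_univ U
  have hform (u : QUnitary n) (hu : u ∈ Submonoid.closure s) :
      ∃ V ∈ circuits gateFamily n, ∃ φ : ℝ,
        (u : Operator n) = Complex.exp (φ * Complex.I) • V := by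
    induction hu using Submonoid.closure_induction with
    | mem u hu =>
      rcases hu with ⟨z, hz, huz⟩ | hu
      · refine ⟨1, one_mem _, Complex.arg z, ?_⟩
        have h := Complex.norm_mul_exp_arg_mul_I z
        rw [hz, Complex.ofReal_one, one_mul] at h
        rw [huz, h]
      · exact ⟨u, hu, 0, by simp⟩
    | one => exact ⟨1, one_mem _, 0, by simp⟩
    | mul u v _ _ hu hv =>
      obtain ⟨V, hV, φ, hφ⟩ := hu
      obtain ⟨W, hW, ψ, hψ⟩ := hv
      refine ⟨V * W, mul_mem hV hW, φ + ψ, ?_⟩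
      rw [Submonoid.coe_mul, hφ, hψ, smul_mul_smul_comm, ← Complex.exp_add]
      push_cast
      rw [add_mul]
  obtain ⟨u, hu, hdist⟩ := Metric.mem_closure_iff.1 hU δ hδ
  obtain ⟨V, hV, φ, hφ⟩ := hform u hu
  refine ⟨V, hV, φ, ?_⟩
  rwa [← hφ, ← dist_eq_norm]
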